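/- Work over $\mathbb{C}$. Let $X\subset\mathbb{P}^4$ be a smooth cubic threefold defined by an irreducible homogeneous polynomial of degree $3$, and let $\operatorname{Aut}(X)=\{f\in\operatorname{Aut}(\mathbb{P}^4)=\operatorname{PGL}(5,\mathbb{C}) : f(X)=X\}$. Let $X_1\subset\mathbb{P}^4$ be the Fermat cubic threefold $x_1^3+x_2^3+x_3^3+x_4^3+x_5^3=0$. Let $G$ be a subgroup of $\operatorname{Aut}(X)$ of order $3^5k$ for some positive integer $k$. Then: 1. $X$ is isomorphic to $X_1$; more precisely, there is $g\in\operatorname{PGL}(5,\mathbb{C})$ with $g(X)=X_1$. 2. $G$ is isomorphic to a subgroup of $\operatorname{Aut}(X_1)$. 3. $G$ is isomorphic to a subgroup of $C_3^4\rtimes S_5$, where $C_3^4$ is realized as $\{(a_1,\dots,a_5)\in C_3^5 : a_1a_2a_3a_4a_5=1\}$ and $S_5$ acts by permuting the five coordinates. -/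

import Mathlib

open scoped MatrixGroups Pointwise LinearAlgebra.Projectivization

/-- Complex projective four-space, as the set of lines through the origin of `ℂ⁵`. -/
abbrev P4 : Type := ℙ ℂ (Fin 5 → ℂ)

/-- The zero locus in `ℙ⁴` of a homogeneous polynomial of positive degree in five variables:
the lines on which the polynomial vanishes. -/
def projZeroLocus (F : MvPolynomial (Fin 5) ℂ) : Set P4 :=
  {p | ∀ v ∈ p.submodule, MvPolynomial.eval v F = 0}

/-- For homogeneous polynomials it is enough to test one representative. -/
theorem mk_mem_projZeroLocus {F : MvPolynomial (Fin 5) ℂ} {d : ℕ}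
    (hF : F.IsHomogeneous d) {v : Fin 5 → ℂ} (hv : v ≠ 0) :
    Projectivization.mk ℂ v hv ∈ projZeroLocus F ↔ MvPolynomial.eval v F = 0 := by
  constructor
  · intro h
    exact h v (by simp [Projectivization.submodule_mk, Submodule.mem_span_singleton_self])
  · intro h w hw
    rw [Projectivization.submodule_mk, Submodule.mem_span_singleton] at hw
    obtain ⟨c, rfl⟩ := hw
    have key : MvPolynomial.eval (c • v) F = c ^ d * MvPolynomial.eval v F := by
      rw [MvPolynomial.eval_eq, MvPolynomial.eval_eq, Finset.mul_sum]
      refine Finset.sum_congr rfl fun m hm => ?_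
      have hdeg : ∑ i ∈ m.support, m i = d := by
        have := hF (MvPolynomial.mem_support_iff.mp hm)
        simpa [Finsupp.weight_apply, Finsupp.sum] using this
      simp only [Pi.smul_apply, smul_eq_mul, mul_pow, Finset.prod_mul_distrib,
        Finset.prod_pow_eq_pow_sum, hdeg]
      ring
    rw [key, h, mul_zero]

/-- `X ⊆ ℙ⁴` is a smooth cubic threefold: it is the zero locus of an irreducible cubic form `F`
such that at no point of `X` all the partial derivatives of `F` vanish. -/
def IsSmoothCubicThreefold (X : Set P4) : Prop :=
  ∃ F : MvPolynomial (Fin 5) ℂ, Irreducible F ∧ F.IsHomogeneous 3 ∧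
    (∀ v : Fin 5 → ℂ, v ≠ 0 → MvPolynomial.eval v F = 0 →
      ∃ i, MvPolynomial.eval v (MvPolynomial.pderiv i F) ≠ 0) ∧
    X = projZeroLocus F

/-- `Aut(X) = {f ∈ Aut(ℙ⁴) | f(X) = X}`, where `Aut(ℙ⁴) = PGL(5, ℂ)` acts on `ℙ⁴` by
`[A] • [v] = [A v]`. -/
noncomputable def cubicAut (X : Set P4) : Subgroup PGL(5, ℂ) :=
  MulAction.stabilizer PGL(5, ℂ) X

/-- The Fermat cubic threefold `x₁³ + x₂³ + x₃³ + x₄³ + x₅³ = 0`. -/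
def fermatCubic : Set P4 :=
  projZeroLocus (∑ i, MvPolynomial.X i ^ 3)

/-- The group `C₃⁴`, realized as the vectors in `C₃⁵` whose entries have product `1`. -/
def C3pow4 : Subgroup (Fin 5 → Multiplicative (ZMod 3)) where
  carrier := {a | ∏ i, a i = 1}
  one_mem' := by simp
  mul_mem' := by
    intro a b ha hb
    simp only [Set.mem_ofPred_eq, Pi.mul_apply, Finset.prod_mul_distrib] at *
    rw [ha, hb, one_mul]
  inv_mem' := by
    intro a ha
    simp only [Set.mem_ofPred_eq, Pi.inv_apply, Finset.prod_inv_distrib] at *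
    rw [ha, inv_one]

/-- The permutation action of `S₅` on `C₃⁴`: `(σ a)ᵢ = a_{σ⁻¹ i}`. -/
def permC3pow4 : Equiv.Perm (Fin 5) →* MulAut C3pow4 where
  toFun σ :=
    { toFun := fun a => ⟨fun i => a.1 (σ⁻¹ i), (Equiv.prod_comp σ⁻¹ a.1).trans a.2⟩
      invFun := fun a => ⟨fun i => a.1 (σ i), (Equiv.prod_comp σ a.1).trans a.2⟩
      left_inv := fun a => by ext i; simp
      right_inv := fun a => by ext i; simp
      map_mul' := fun a b => rfl }
  map_one' := rfl
  map_mul' σ τ := by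
    ext a i
    simp [mul_inv_rev]

/-- The group `C₃⁴ ⋊ S₅`, with `S₅` permuting the five coordinates. -/
abbrev C3pow4S5 : Type := C3pow4 ⋊[permC3pow4] Equiv.Perm (Fin 5)

/-! A group of order `3 ^ 5 * k` contains a subgroup of order `3 ^ 5`, and such a subgroup of
automorphisms already forces the equation of `X` to be a sum of five cubes.

Lifted to linear maps fixing the cubic form, it becomes a group of order `3 ^ 6`, the extra factor
being the scalar cube roots of unity. A finite `3`-group acting on `ℂ⁵` has a diagonalizable
subgroup of index dividing `5!` (`IsPGroup.exists_diagonal_subgroup`), here of order at least `3 ^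
5`. In an eigenbasis with characters `χᵢ`, smoothness gives for each `i` a monomial `xᵢ² x_{f i}`
with nonzero coefficient, so `χᵢ² χ_{f i} = 1`. Counting shows that so large a group allows only `f
= id` (`eq_self_of_character_relations`) and contains every diagonal matrix of cube roots of unity.
Hence no mixed monomial survives, and rescaling the basis gives the Fermat form.

For the two embeddings, conjugation carries `G` into the automorphisms of the Fermat cubic. These
are classes of monomial matrices, because the polarized form `∑ uᵢ vᵢ wᵢ` forces each row to have a
single nonzero entry. After rescaling, their entries are cube roots of unity with product `1`. -/

/-! ### Self-centralizing abelian normal subgroups of `p`-groups. -/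

namespace IsPGroup

variable {p : ℕ} [Fact p.Prime] {G : Type*} [Group G] [Finite G]

/-- A nontrivial normal subgroup of a finite `p`-group meets the center nontrivially. -/
theorem exists_ne_one_mem_center (hG : IsPGroup p G) (N : Subgroup G) [N.Normal] (hN : N ≠ ⊥) :
    ∃ x ∈ N, x ≠ 1 ∧ x ∈ Subgroup.center G := by
  let _ : MulAction G N := MulAction.compHom N (MulAut.conjNormal (H := N))
  have hsmul : ∀ (g : G) (x : N), ((g • x : N) : G) = g * x * g⁻¹ := fun g x =>
    MulAut.conjNormal_apply g x
  have hcard : p ∣ Nat.card N := by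
    refine ((hG.to_subgroup N).card_eq_or_dvd).resolve_left fun h => hN ?_
    exact Subgroup.eq_bot_of_card_eq _ h
  -- Conjugation fixes `1`, and the number of fixed points in `N` is divisible by `p`, so there is
  -- another one.
  obtain ⟨x, hx, hx1⟩ := hG.exists_fixed_point_of_prime_dvd_card_of_fixed_point N hcard
    (a := 1) (fun g => Subtype.ext (by rw [hsmul]; simp))
  refine ⟨x, x.2, fun h => hx1 (Subtype.ext h.symm), Subgroup.mem_center_iff.mpr fun g => ?_⟩
  have := congrArg Subtype.val (hx g)
  rw [hsmul] at this
  exact mul_inv_eq_iff_eq_mul.mp this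

/-- A finite `p`-group has a normal abelian subgroup containing its own centralizer. -/
theorem exists_normal_comm_centralizer_le (hG : IsPGroup p G) :
    ∃ A : Subgroup G, A.Normal ∧ (∀ a ∈ A, ∀ b ∈ A, a * b = b * a) ∧
      ∀ x, (∀ a ∈ A, a * x = x * a) → x ∈ A := by
  obtain ⟨A, hA⟩ := (Set.toFinite {A : Subgroup G | A.Normal ∧
    ∀ a ∈ A, ∀ b ∈ A, a * b = b * a}).exists_maximal
      ⟨⊥, inferInstance, by simp +contextual⟩
  obtain ⟨⟨hn, hc⟩, hmax⟩ := hA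
  refine ⟨A, hn, hc, ?_⟩
  by_contra! hcon
  obtain ⟨y, hy, hyA⟩ := hcon
  have hle : ∀ x, x ∈ Subgroup.centralizer (A : Set G) ↔ ∀ a ∈ A, a * x = x * a := fun x =>
    Subgroup.mem_centralizer_iff
  -- If the centralizer exceeds the maximal `A`, its image in `G ⧸ A` contains a nontrivial central
  -- element. The preimage `B` of the cyclic group it generates is again normal and abelian,
  -- contradicting maximality.
  let N := (Subgroup.centralizer (A : Set G)).map (QuotientGroup.mk' A)
  have hNn : N.Normal := Subgroup.Normal.map inferInstance _ (QuotientGroup.mk'_surjective A)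
  obtain ⟨x', hx'N, hx'1, hx'c⟩ := (hG.to_quotient A).exists_ne_one_mem_center N (by
    intro h
    have : QuotientGroup.mk' A y ∈ N := ⟨y, (hle y).mpr hy, rfl⟩
    rw [h, Subgroup.mem_bot] at this
    exact hyA ((QuotientGroup.eq_one_iff y).mp this))
  obtain ⟨x, hx, rfl⟩ := hx'N
  have hxc : ∀ a ∈ A, Commute a x := (hle x).mp hx
  have hz : (Subgroup.zpowers (QuotientGroup.mk' A x)).Normal := ⟨by
    rintro _ ⟨n, rfl⟩ g
    have : g * QuotientGroup.mk' A x ^ n * g⁻¹ = QuotientGroup.mk' A x ^ n := by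
      rw [Subgroup.mem_center_iff.mp (Subgroup.zpow_mem _ hx'c n) g, mul_inv_cancel_right]
    exact ⟨n, this.symm⟩⟩
  let B := (Subgroup.zpowers (QuotientGroup.mk' A x)).comap (QuotientGroup.mk' A)
  have hB : ∀ b ∈ B, ∃ (n : ℤ) (a : G), a ∈ A ∧ b = x ^ n * a := by
    rintro b ⟨n, hn⟩
    refine ⟨n, (x ^ n)⁻¹ * b, ?_, by group⟩
    rw [← QuotientGroup.eq]
    simpa using hn
  have hBmem : B ∈ {A : Subgroup G | A.Normal ∧ ∀ a ∈ A, ∀ b ∈ A, a * b = b * a} := by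
    refine ⟨Subgroup.Normal.comap hz _, fun b hb b' hb' => ?_⟩
    obtain ⟨n, a, ha, rfl⟩ := hB b hb
    obtain ⟨m, a', ha', rfl⟩ := hB b' hb'
    have h1 : Commute (x ^ n) (x ^ m * a') :=
      ((Commute.refl x).zpow_zpow n m).mul_right ((hxc a' ha').symm.zpow_left n)
    have h2 : Commute a (x ^ m * a') := ((hxc a ha).zpow_right m).mul_right (hc a ha a' ha')
    exact h1.mul_left h2
  have hAB : A ≤ B := fun a ha => by
    change QuotientGroup.mk' A a ∈ Subgroup.zpowers (QuotientGroup.mk' A x)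
    rw [show QuotientGroup.mk' A a = 1 from (QuotientGroup.eq_one_iff a).mpr ha]
    exact Subgroup.one_mem _
  have hxA : x ∈ A := hmax hBmem hAB (Subgroup.mem_zpowers _)
  exact hx'1 ((QuotientGroup.eq_one_iff x).mpr hxA)

end IsPGroup

/-! ### Simultaneous diagonalization up to index dividing `n!`. -/

section Diagonalization

variable {V : Type*} [AddCommGroup V] [Module ℂ V]

theorem Module.End.isSemisimple_of_pow_eq_one {f : Module.End ℂ V} {n : ℕ} (hn : n ≠ 0)
    (hf : f ^ n = 1) : f.IsSemisimple := by
  refine Module.End.isSemisimple_of_squarefree_aeval_eq_zero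
    (p := Polynomial.X ^ n - Polynomial.C 1) ?_ (by simp [hf])
  exact (Polynomial.separable_X_pow_sub_C 1 (Nat.cast_ne_zero.mpr hn) one_ne_zero).squarefree

variable [FiniteDimensional ℂ V]

/-- A finite commutative group of linear maps has a basis of common eigenvectors. -/
theorem exists_common_eigenbasis {A : Type*} [Group A] [Finite A]
    (hA : ∀ a b : A, a * b = b * a) (ρ : A →* Module.End ℂ V) {n : ℕ}
    (hn : Module.finrank ℂ V = n) :
    ∃ (b : Module.Basis (Fin n) ℂ V) (χ : Fin n → A → ℂ), ∀ a i, ρ a (b i) = χ i a • b i := by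
  have hss : ∀ a, (ρ a).IsSemisimple := fun a =>
    Module.End.isSemisimple_of_pow_eq_one (Nat.card_pos (α := A)).ne'
      (by rw [← map_pow, pow_card_eq_one', map_one])
  have htop := Module.End.iSup_iInf_maxGenEigenspace_eq_top_of_iSup_maxGenEigenspace_eq_top_of_commute
    (fun a => ρ a) (fun a b _ => by
      change ρ a * ρ b = ρ b * ρ a
      rw [← map_mul, ← map_mul, hA]) (fun a => Module.End.iSup_maxGenEigenspace_eq_top _)
  let S : Set V := {v | ∀ a, ∃ c : ℂ, ρ a v = c • v}
  have hS : ⊤ ≤ Submodule.span ℂ S := by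
    rw [← htop]
    refine iSup_le fun χ v hv => Submodule.subset_span fun a => ⟨χ a, ?_⟩
    have := (Submodule.mem_iInf _).mp hv a
    rw [(hss a).isFinitelySemisimple.maxGenEigenspace_eq_eigenspace] at this
    exact Module.End.mem_eigenspace_iff.mp this
  let b₀ := Module.Basis.ofSpan hS
  have : Finite _ := Module.Finite.finite_basis b₀
  let b : Module.Basis (Fin n) ℂ V := b₀.reindex (Finite.equivFinOfCardEq
    ((Module.finrank_eq_nat_card_basis b₀).symm.trans hn))
  have hb : ∀ i, b i ∈ S := fun i => by
    rw [Module.Basis.reindex_apply]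
    exact Module.Basis.ofSpan_subset hS ⟨_, rfl⟩
  choose χ hχ using hb
  exact ⟨b, χ, fun a i => hχ i a⟩

/-- A finite `p`-group acting faithfully on an `n`-dimensional space has a diagonalizable subgroup
whose index divides `n!`. -/
theorem IsPGroup.exists_diagonal_subgroup {p : ℕ} [Fact p.Prime] {Q : Type*} [Group Q] [Finite Q]
    (hQ : IsPGroup p Q) (ρ : Q →* Module.End ℂ V) (hρ : Function.Injective ρ) {n : ℕ}
    (hn : Module.finrank ℂ V = n) :
    ∃ A : Subgroup Q, A.index ∣ n.factorial ∧
      ∃ (b : Module.Basis (Fin n) ℂ V) (χ : Fin n → A → ℂ),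
        ∀ (a : A) i, ρ a (b i) = χ i a • b i := by
  obtain ⟨A, hAn, hAc, hA⟩ := hQ.exists_normal_comm_centralizer_le
  obtain ⟨b, χ, hχ⟩ := exists_common_eigenbasis (A := A)
    (fun a b => Subtype.ext (hAc a a.2 b b.2)) (ρ.comp A.subtype) hn
  replace hχ : ∀ (a : A) i, ρ a (b i) = χ i a • b i := hχ
  refine ⟨A, ?_, b, χ, hχ⟩
  -- `Q` permutes the weights of the normal subgroup `A`: `ρ g` sends a vector of weight `ψ` to one
  -- of weight `g • ψ`. There are at most `n` weights, as the `χ i` may coincide.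
  let act : MulAction Q (A → ℂ) :=
    { smul := fun g ψ a => ψ (MulAut.conjNormal g⁻¹ a)
      one_smul := fun ψ => by
        funext a
        change ψ (MulAut.conjNormal (1 : Q)⁻¹ a) = ψ a
        simp
      mul_smul := fun g h ψ => by
        funext a
        change ψ (MulAut.conjNormal (g * h)⁻¹ a) =
          ψ (MulAut.conjNormal h⁻¹ (MulAut.conjNormal g⁻¹ a))
        rw [mul_inv_rev, map_mul]
        rfl }
  have smul_def : ∀ (g : Q) (ψ : A → ℂ) (a : A), (g • ψ) a = ψ (MulAut.conjNormal g⁻¹ a) :=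
    fun _ _ _ => rfl
  have weight : ∀ (g : Q) (a : A) i, ρ a (ρ g (b i)) = (g • χ i) a • ρ g (b i) := by
    intro g a i
    have h1 : (a : Q) * g = g * (MulAut.conjNormal g⁻¹ a : A) := by
      rw [MulAut.conjNormal_apply]
      group
    rw [← Module.End.mul_apply, ← map_mul, h1, map_mul, Module.End.mul_apply, hχ, map_smul,
      smul_def]
  let W : SubMulAction Q (A → ℂ) :=
    { carrier := Set.range χ
      smul_mem' := by
        rintro g _ ⟨i, rfl⟩
        have hne : ρ g (b i) ≠ 0 := by
          intro h
          have h2 : ρ (g⁻¹ * g) (b i) = 0 := by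
            rw [map_mul, Module.End.mul_apply, h, map_zero]
          rw [inv_mul_cancel, map_one] at h2
          exact b.ne_zero i h2
        obtain ⟨j, hj⟩ : ∃ j, b.repr (ρ g (b i)) j ≠ 0 := by
          by_contra! hcon
          exact hne (b.repr.map_eq_zero_iff.mp (Finsupp.ext hcon))
        refine ⟨j, ?_⟩
        funext a
        have h3 : ∀ v, b.repr (ρ a v) j = χ j a * b.repr v j := by
          intro v
          have : (b.coord j) ∘ₗ ρ a = χ j a • b.coord j := by
            refine b.ext fun k => ?_
            by_cases hk : k = j
            · subst hk
              simp [hχ]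
            · simp [hχ, hk]
          exact congrArg (fun f : V →ₗ[ℂ] ℂ => f v) this
        have h4 := h3 (ρ g (b i))
        rw [weight, map_smul, Finsupp.smul_apply, smul_eq_mul] at h4
        exact (mul_right_cancel₀ hj h4).symm }
  have hWfin : Finite W := Set.finite_range χ
  have hWcard : Nat.card W ≤ n := by
    have := Finite.card_range_le χ
    rw [Nat.card_fin] at this
    exact this
  let φ := MulAction.toPermHom Q W
  -- An element fixing every weight preserves the weight spaces, so it commutes with `A` and lies in
  -- `A`.
  have hker : φ.ker ≤ A := by
    intro g hg
    refine hA g fun a ha => hρ (b.ext fun i => ?_)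
    have h5 : g • χ i = χ i := congrArg Subtype.val
      (congrArg (fun e : Equiv.Perm W => e ⟨χ i, i, rfl⟩) (MonoidHom.mem_ker.mp hg))
    have h6 := weight g ⟨a, ha⟩ i
    rw [h5] at h6
    rw [map_mul, map_mul, Module.End.mul_apply, Module.End.mul_apply, h6,
      show ρ a (b i) = _ from hχ ⟨a, ha⟩ i, map_smul]
  refine (Subgroup.index_dvd_of_le hker).trans ?_
  rw [Subgroup.index_ker]
  refine (Subgroup.card_subgroup_dvd_card φ.range).trans ?_
  rw [Nat.card_perm]
  exact Nat.factorial_dvd_factorial hWcard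

end Diagonalization

/-! ### Counting a `3`-group through relations between its characters. -/

section CharacterRelations

theorem nine_dvd_orderOf {G : Type*} [Group G] {x : G} {k : ℕ} (hx : x ^ 3 ^ k = 1)
    (hx3 : x ^ 3 ≠ 1) : 9 ∣ orderOf x := by
  obtain ⟨t, -, ht⟩ := (Nat.dvd_prime_pow Nat.prime_three).mp (orderOf_dvd_of_pow_eq_one hx)
  rw [ht]
  have h2 : 2 ≤ t := by
    by_contra! h
    refine hx3 (orderOf_dvd_iff_pow_eq_one.mp ?_)
    rw [ht]
    exact pow_dvd_pow 3 (Nat.le_of_lt_succ h)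
  exact pow_dvd_pow 3 h2

/-- A group of characters killed by `n` and determined by its values at the places in `S` has at
most `n ^ #S` elements. -/
theorem card_le_pow_of_determined {A ι : Type*} [Group A] (χ : A →* ι → ℂˣ) (n : ℕ) [NeZero n]
    (S : Finset ι) (hpow : ∀ a, ∀ i ∈ S, χ a i ^ n = 1)
    (hdet : ∀ a, (∀ i ∈ S, χ a i = 1) → a = 1) : Nat.card A ≤ n ^ S.card := by
  let φ : A →* (S → rootsOfUnity n ℂ) :=
    { toFun := fun a i => ⟨χ a i, hpow a i i.2⟩
      map_one' := by ext; simp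
      map_mul' := fun a b => by ext; simp }
  have hφ : Function.Injective φ := by
    rw [injective_iff_map_eq_one]
    intro a ha
    refine hdet a fun i hi => ?_
    exact congrArg Subtype.val (congrFun ha ⟨i, hi⟩)
  have := Nat.card_le_card_of_injective φ hφ
  rwa [Nat.card_fun, Nat.card_eq_fintype_card (α := S), Fintype.card_coe,
    Complex.card_rootsOfUnity] at this

variable {A : Type*} [Group A] {χ : A →* Fin 5 → ℂˣ} {f : Fin 5 → Fin 5}

/-- The relation reads `χ_{f i} = χᵢ⁻²`. It is useful because `-2` has order `3` modulo `9`, so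
orbits of `f` are controlled by values of order divisible by `9`. -/
theorem apply_iterate_eq_zpow {ι : Type*} {χ : A →* ι → ℂˣ} {f : ι → ι}
    (hf : ∀ a i, χ a i ^ 2 * χ a (f i) = 1) (a : A) (i : ι) (m : ℕ) :
    χ a (f^[m] i) = χ a i ^ ((-2 : ℤ) ^ m) := by
  induction m with
  | zero => simp
  | succ m ih =>
    rw [Function.iterate_succ_apply', pow_succ, zpow_mul, ← ih, zpow_neg]
    exact eq_inv_of_mul_eq_one_right (hf a _)

/-- A character value of order divisible by `9` forces a `3`-cycle of `f`. -/
theorem exists_three_cycle (hA : IsPGroup 3 A) (hf : ∀ a i, χ a i ^ 2 * χ a (f i) = 1)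
    {a : A} {k : Fin 5} (hk : χ a k ^ 3 ≠ 1) :
    ∃ p, f (f (f p)) = p ∧ f p ≠ p ∧ χ a p ≠ 1 := by
  obtain ⟨n, hn⟩ := hA a
  have h9 : 9 ∣ orderOf (χ a k) := nine_dvd_orderOf (k := n)
    (by rw [← Pi.pow_apply, ← map_pow, hn]; simp) hk
  have hz : ∀ {z w : ℤ}, χ a k ^ z = χ a k ^ w → (9 : ℤ) ∣ z - w := by
    intro z w h
    refine dvd_trans (Int.natCast_dvd_natCast.mpr h9) (orderOf_dvd_iff_zpow_eq_one.mpr ?_)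
    rw [zpow_sub, h, mul_inv_cancel]
  have hiter : ∀ {m l : ℕ}, f^[m] k = f^[l] k → (9 : ℤ) ∣ (-2) ^ m - (-2) ^ l := by
    intro m l h
    apply hz
    rw [← apply_iterate_eq_zpow hf, ← apply_iterate_eq_zpow hf, h]
  -- Pigeonhole: six iterates lie in a set of five elements.
  obtain ⟨m, l, hml, hl, h⟩ : ∃ m l : ℕ, m < l ∧ l < 6 ∧ f^[m] k = f^[l] k := by
    obtain ⟨x, y, hxy, h⟩ := Fintype.exists_ne_map_eq_of_card_lt
      (fun x : Fin 6 => f^[(x : ℕ)] k) (by simp)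
    rcases lt_or_gt_of_ne hxy with hlt | hlt
    · exact ⟨x, y, hlt, y.2, h⟩
    · exact ⟨y, x, hlt, x.2, h.symm⟩
  -- Since `-2` has order `3` modulo `9`, `l - m` is a multiple of `3`, and it is less than `6`.
  have hdiff : l = m + 3 ∧ m < 3 := by
    have := hiter h
    interval_cases l <;> interval_cases m <;> omega
  obtain ⟨rfl, hm⟩ := hdiff
  refine ⟨f^[m] k, ?_, ?_, ?_⟩
  · rw [← Function.iterate_succ_apply' f, ← Function.iterate_succ_apply' f,
      ← Function.iterate_succ_apply' f, h]
  · intro h1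
    rw [← Function.iterate_succ_apply' f] at h1
    have := hiter h1
    interval_cases m <;> revert this <;> decide
  · intro h1
    rw [apply_iterate_eq_zpow hf, ← zpow_zero (χ a k)] at h1
    have := hz h1
    interval_cases m <;> revert this <;> decide

/-- Five characters of a `3`-group of order at least `3 ^ 5`, jointly faithful and subject to the
relations `χᵢ² χ_{f i} = 1`, satisfy `f i = i`. -/
theorem eq_self_of_character_relations [Finite A] (hA : IsPGroup 3 A)
    (hχ : Function.Injective χ)
    (hf : ∀ a i, χ a i ^ 2 * χ a (f i) = 1) (hcard : 3 ^ 5 ≤ Nat.card A) (i : Fin 5) :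
    f i = i := by
  have hstep : ∀ {a i}, χ a i = 1 → χ a (f i) = 1 := fun {a i} h => by
    simpa [h] using hf a i
  have hone : ∀ {a}, (∀ i, χ a i = 1) → a = 1 := fun {a} h =>
    hχ (by rw [map_one]; exact funext h)
  by_cases hcube : ∀ a k, χ a k ^ 3 = 1
  -- If `f i ≠ i`, then `χ_{f i} = χᵢ⁻² = χᵢ`, so the four characters other than `χᵢ` determine the
  -- element, giving at most `3 ^ 4` elements.
  · by_contra hi
    have hinv : ∀ a, χ a (f i) = χ a i := fun a => by
      have h1 := hf a i
      have h2 := hcube a i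
      rw [pow_succ] at h2
      exact mul_left_cancel (h1.trans h2.symm)
    have := card_le_pow_of_determined χ 3 (Finset.univ.erase i) (fun a k _ => hcube a k)
      (fun a h => hone fun k => by
        by_cases hk : k = i
        · rw [hk, ← hinv]
          exact h _ (by simpa using hi)
        · exact h k (by simpa using hk))
    rw [Finset.card_erase_of_mem (Finset.mem_univ i), Finset.card_fin] at this
    omega
  · push Not at hcube
    obtain ⟨a₀, k₀, hk₀⟩ := hcube
    have distinct : ∀ {p}, f (f (f p)) = p → f p ≠ p →
        ({p, f p, f (f p)} : Finset (Fin 5)).card = 3 := by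
      intro p h3 h1
      refine Finset.card_eq_three.mpr ⟨p, f p, f (f p), h1.symm, fun h => ?_, fun h => ?_, rfl⟩
      · exact h1 ((congrArg f h).trans h3)
      · exact h1 (h.trans ((congrArg f h).trans h3))
    obtain ⟨p, hp3, hp1, -⟩ := exists_three_cycle hA hf hk₀
    -- With a `3`-cycle through `p`, the image of `χ_p` has order at most `9` and its kernel at most
    -- `9`, so the group has at most `81 < 3 ^ 5` elements.
    let ψ : A →* ℂˣ := (Pi.evalMonoidHom (fun _ : Fin 5 => ℂˣ) p).comp χ
    have hψ : ∀ a, ψ a = χ a p := fun _ => rfl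
    have hrange : Nat.card ψ.range ≤ 9 := by
      have hle : ψ.range ≤ rootsOfUnity 9 ℂ := by
        rintro _ ⟨a, rfl⟩
        have h := apply_iterate_eq_zpow hf a p 3
        change χ a (f (f (f p))) = _ at h
        rw [hp3] at h
        rw [mem_rootsOfUnity, hψ]
        -- Going once around the cycle gives `χ_p = χ_p ^ (-8)`.
        have h8 : χ a p * χ a p ^ (8 : ℤ) = 1 := by
          nth_rewrite 1 [h]
          rw [← zpow_add]
          norm_num
        rw [pow_succ, mul_comm]
        exact_mod_cast h8
      have := Subgroup.card_le_of_le hle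
      rwa [Complex.card_rootsOfUnity] at this
    have hcyc : ∀ a ∈ ψ.ker, χ a p = 1 ∧ χ a (f p) = 1 ∧ χ a (f (f p)) = 1 := fun a ha =>
      ⟨ha, hstep ha, hstep (hstep ha)⟩
    have hker : Nat.card ψ.ker ≤ 3 ^ 2 := by
      have hSc : (Finset.univ \ {p, f p, f (f p)} : Finset (Fin 5)).card = 2 := by
        rw [Finset.card_sdiff_of_subset (Finset.subset_univ _), distinct hp3 hp1, Finset.card_fin]
      rw [← hSc]
      refine card_le_pow_of_determined (χ.comp ψ.ker.subtype) 3 _ (fun a k _ => ?_) fun a h => ?_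
      · change χ a k ^ 3 = 1
        -- A second `3`-cycle would carry nontrivial values of `a`, hence be disjoint from the
        -- first, and five indices cannot hold both.
        by_contra hk
        obtain ⟨q, hq3, hq1, hq⟩ := exists_three_cycle hA hf hk
        obtain ⟨e1, e2, e3⟩ := hcyc a a.2
        have hq' : χ a (f q) ≠ 1 := fun h => hq (by rw [← hq3]; exact hstep (hstep h))
        have hq'' : χ a (f (f q)) ≠ 1 := fun h => hq (by rw [← hq3]; exact hstep h)
        have hdisj : Disjoint ({p, f p, f (f p)} : Finset (Fin 5)) {q, f q, f (f q)} := by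
          rw [Finset.disjoint_left]
          intro x hx hx'
          have h1 : χ a x = 1 := by
            simp only [Finset.mem_insert, Finset.mem_singleton] at hx
            rcases hx with rfl | rfl | rfl <;> assumption
          simp only [Finset.mem_insert, Finset.mem_singleton] at hx'
          rcases hx' with rfl | rfl | rfl <;> contradiction
        have h6 := Finset.card_union_of_disjoint hdisj
        rw [distinct hp3 hp1, distinct hq3 hq1] at h6
        have := Finset.card_le_univ ({p, f p, f (f p)} ∪ {q, f q, f (f q)} : Finset (Fin 5))
        rw [h6, Fintype.card_fin] at this
        omega
      · obtain ⟨e1, e2, e3⟩ := hcyc a a.2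
        refine Subtype.ext (hone fun k => ?_)
        by_cases hk : k ∈ ({p, f p, f (f p)} : Finset (Fin 5))
        · simp only [Finset.mem_insert, Finset.mem_singleton] at hk
          rcases hk with rfl | rfl | rfl <;> assumption
        · exact h k (by simpa using hk)
    have hmul := ψ.ker.card_mul_index
    rw [Subgroup.index_ker] at hmul
    have := Nat.mul_le_mul hker hrange
    omega

/-- In the situation of `eq_self_of_character_relations` all tuples of cube roots of unity occur. -/
theorem exists_apply_eq_of_character_relations [Finite A] (hA : IsPGroup 3 A)
    (hχ : Function.Injective χ) (hf : ∀ a i, χ a i ^ 2 * χ a (f i) = 1)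
    (hcard : 3 ^ 5 ≤ Nat.card A) (e : Fin 5 → ℂˣ) (he : ∀ i, e i ^ 3 = 1) : ∃ a, χ a = e := by
  have hcube : ∀ a i, χ a i ^ 3 = 1 := fun a i => by
    have := hf a i
    rwa [eq_self_of_character_relations hA hχ hf hcard i, ← pow_succ] at this
  let φ : A → (Fin 5 → rootsOfUnity 3 ℂ) := fun a i => ⟨χ a i, hcube a i⟩
  have hφ : Function.Injective φ := fun a b hab =>
    hχ (funext fun i => congrArg Subtype.val (congrFun hab i))
  have hbij := (Nat.bijective_iff_injective_and_card φ).mpr ⟨hφ, le_antisymm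
    (Nat.card_le_card_of_injective φ hφ) (by
      rwa [Nat.card_fun, Nat.card_fin, Complex.card_rootsOfUnity])⟩
  obtain ⟨a, ha⟩ := hbij.2 fun i => ⟨e i, he i⟩
  exact ⟨a, funext fun i => congrArg Subtype.val (congrFun ha i)⟩

end CharacterRelations

/-! ### Cubic forms and symmetric trilinear forms. -/

open Matrix

/-- A trilinear form is symmetric when it is invariant under the two adjacent transpositions. -/
structure IsSymmTrilinear {V : Type*} [AddCommGroup V] [Module ℂ V]
    (T : V →ₗ[ℂ] V →ₗ[ℂ] V →ₗ[ℂ] ℂ) : Prop where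
  swap_left : ∀ u v w, T u v w = T v u w
  swap_right : ∀ u v w, T u v w = T u w v

namespace IsSymmTrilinear

variable {V W : Type*} [AddCommGroup V] [Module ℂ V] [AddCommGroup W] [Module ℂ W]
  {T : V →ₗ[ℂ] V →ₗ[ℂ] V →ₗ[ℂ] ℂ} {S : W →ₗ[ℂ] W →ₗ[ℂ] W →ₗ[ℂ] ℂ}

/-- A symmetric trilinear form is determined by the associated cubic form. -/
theorem polarization (hT : IsSymmTrilinear T) (u v w : V) : 6 * T u v w =
    T (u + v + w) (u + v + w) (u + v + w) - T (u + v) (u + v) (u + v)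
      - T (u + w) (u + w) (u + w) - T (v + w) (v + w) (v + w)
      + T u u u + T v v v + T w w w := by
  simp only [map_add, LinearMap.add_apply]
  linear_combination -2 * hT.swap_left v u w - 3 * hT.swap_right u w v
    - 2 * hT.swap_left w u v - hT.swap_right v w u - hT.swap_right w v u

/-- By polarization, invariance of the cubic form up to a scalar passes to the trilinear form, where
it can be tested on basis vectors. -/
theorem map_eq_mul (hT : IsSymmTrilinear T) (hS : IsSymmTrilinear S)
    (A : V →ₗ[ℂ] W) (c : ℂ) (h : ∀ v, S (A v) (A v) (A v) = c * T v v v) (u v w : V) :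
    S (A u) (A v) (A w) = c * T u v w := by
  have key : (6 : ℂ) * S (A u) (A v) (A w) = 6 * (c * T u v w) := by
    rw [hS.polarization, mul_left_comm, hT.polarization]
    simp only [← map_add A, h]
    ring
  exact mul_left_cancel₀ (by norm_num) key

end IsSymmTrilinear

namespace MvPolynomial

theorem pderiv_comm_apply {σ R : Type*} [CommRing R] (i j : σ) (F : MvPolynomial σ R) :
    pderiv i (pderiv j F) = pderiv j (pderiv i F) := by
  classical
  have h : ⁅(pderiv i : Derivation R (MvPolynomial σ R) (MvPolynomial σ R)),
      (pderiv j : Derivation R (MvPolynomial σ R) (MvPolynomial σ R))⁆ = 0 := by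
    apply derivation_ext
    intro k
    simp [Derivation.commutator_apply, pderiv_X, Pi.single_apply, apply_ite]
  have := congrArg (fun D => D F) h
  simpa [Derivation.commutator_apply, sub_eq_zero] using this

/-- Every cubic form is the diagonal of a symmetric trilinear form, which then also computes its
partial derivatives. -/
theorem IsHomogeneous.exists_symmTrilinear {σ : Type*} [Fintype σ] [DecidableEq σ]
    {F : MvPolynomial σ ℂ}
    (hF : F.IsHomogeneous 3) :
    ∃ T : (σ → ℂ) →ₗ[ℂ] (σ → ℂ) →ₗ[ℂ] (σ → ℂ) →ₗ[ℂ] ℂ, IsSymmTrilinear T ∧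
      (∀ v, T v v v = eval v F) ∧
      ∀ v i, 3 * T v v (Pi.single i 1) = eval v (pderiv i F) := by
  -- The third derivatives are constant, so evaluation at `0` loses nothing. Euler's identity in
  -- degrees `1`, `2`, `3` recovers the lower derivatives and `F`, and `6 = 1 * 2 * 3`.
  let t : σ → σ → σ → ℂ := fun i j k => 6⁻¹ * eval 0 (pderiv i (pderiv j (pderiv k F)))
  have t_left : ∀ i j k, t i j k = t j i k := fun i j k => by
    simp only [t, pderiv_comm_apply i j]
  have t_right : ∀ i j k, t i j k = t i k j := fun i j k => by
    simp only [t, pderiv_comm_apply j k]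
  have h1 : ∀ k, (pderiv k F).IsHomogeneous 2 := fun k => hF.pderiv
  have h2 : ∀ j k, (pderiv j (pderiv k F)).IsHomogeneous 1 := fun j k => (h1 k).pderiv
  have h3 : ∀ i j k, (pderiv i (pderiv j (pderiv k F))).IsHomogeneous 0 :=
    fun i j k => (h2 j k).pderiv
  have e3 : ∀ v i j k, eval v (pderiv i (pderiv j (pderiv k F))) = 6 * t i j k := by
    intro v i j k
    have := totalDegree_eq_zero_iff_eq_C.mp ((totalDegree_zero_iff_isHomogeneous _).mpr (h3 i j k))
    simp only [t]
    rw [this]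
    simp
  have e2 : ∀ v j k, eval v (pderiv j (pderiv k F)) = 6 * ∑ i, v i * t i j k := by
    intro v j k
    have := congrArg (eval v) (h2 j k).sum_X_mul_pderiv
    simp only [map_sum, map_mul, eval_X, e3, one_smul] at this
    rw [← this, Finset.mul_sum]
    exact Finset.sum_congr rfl fun i _ => by ring
  have e1 : ∀ v k, eval v (pderiv k F) = 3 * ∑ i, ∑ j, v i * v j * t i j k := by
    intro v k
    have := congrArg (eval v) (h1 k).sum_X_mul_pderiv
    simp only [map_sum, map_mul, eval_X, e2, nsmul_eq_mul] at this
    rw [Finset.sum_comm]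
    have h : (2 : ℂ) * eval v (pderiv k F) = 2 * (3 * ∑ j, ∑ i, v i * v j * t i j k) := by
      simp only [Nat.cast_ofNat, map_ofNat] at this
      rw [← this, ← mul_assoc, Finset.mul_sum]
      refine Finset.sum_congr rfl fun j _ => ?_
      rw [Finset.mul_sum, Finset.mul_sum, Finset.mul_sum]
      exact Finset.sum_congr rfl fun i _ => by ring
    exact mul_left_cancel₀ two_ne_zero h
  have e0 : ∀ v, eval v F = ∑ i, ∑ j, ∑ k, v i * v j * v k * t i j k := by
    intro v
    have := congrArg (eval v) hF.sum_X_mul_pderiv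
    simp only [map_sum, map_mul, eval_X, e1, nsmul_eq_mul, Nat.cast_ofNat, map_ofNat] at this
    refine mul_left_cancel₀ (three_ne_zero (α := ℂ)) ?_
    rw [← this, Finset.mul_sum]
    simp only [Finset.mul_sum]
    rw [Finset.sum_comm]
    refine Finset.sum_congr rfl fun i _ => ?_
    rw [Finset.sum_comm]
    exact Finset.sum_congr rfl fun j _ => Finset.sum_congr rfl fun k _ => by ring
  let T : (σ → ℂ) →ₗ[ℂ] (σ → ℂ) →ₗ[ℂ] (σ → ℂ) →ₗ[ℂ] ℂ :=
    ∑ i, ∑ j, ∑ k, (LinearMap.proj i).smulRight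
      ((LinearMap.proj j).smulRight (t i j k • LinearMap.proj k))
  have hT : ∀ u v w, T u v w = ∑ i, ∑ j, ∑ k, u i * v j * w k * t i j k := by
    intro u v w
    simp only [T, LinearMap.sum_apply, LinearMap.smulRight_apply, LinearMap.proj_apply,
      LinearMap.smul_apply, smul_eq_mul]
    exact Finset.sum_congr rfl fun i _ => Finset.sum_congr rfl fun j _ =>
      Finset.sum_congr rfl fun k _ => by ring
  refine ⟨T, ⟨fun u v w => ?_, fun u v w => ?_⟩, fun v => by rw [hT, e0], fun v l => ?_⟩
  · rw [hT, hT, Finset.sum_comm]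
    exact Finset.sum_congr rfl fun i _ => Finset.sum_congr rfl fun j _ =>
      Finset.sum_congr rfl fun k _ => by rw [t_left]; ring
  · rw [hT, hT]
    refine Finset.sum_congr rfl fun i _ => ?_
    rw [Finset.sum_comm]
    exact Finset.sum_congr rfl fun j _ => Finset.sum_congr rfl fun k _ => by rw [t_right]; ring
  · rw [hT, e1]
    simp [Pi.single_apply]

/-- A form vanishing on the zero locus of an irreducible form of the same degree is a multiple
of it. -/
theorem eq_C_mul_of_zeros {σ : Type*} [Finite σ] {F G : MvPolynomial σ ℂ} {d : ℕ}
    (hF : Irreducible F) (hFd : F.IsHomogeneous d)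
    (hGd : G.IsHomogeneous d) (h : ∀ v, eval v F = 0 → eval v G = 0) :
    ∃ c : ℂ, G = C c * F := by
  have hprime : (Ideal.span {F}).IsPrime :=
    (Ideal.span_singleton_prime hF.ne_zero).mpr hF.prime
  have hmem : G ∈ vanishingIdeal ℂ (zeroLocus ℂ (Ideal.span {F})) := by
    intro v hv
    have := hv F (Ideal.mem_span_singleton_self F)
    simpa [aeval_eq_eval] using h v (by simpa [aeval_eq_eval] using this)
  -- By the Nullstellensatz `F` divides `G`; equality of degrees makes the cofactor constant.
  rw [IsPrime.vanishingIdeal_zeroLocus, Ideal.mem_span_singleton] at hmem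
  obtain ⟨H, rfl⟩ := hmem
  by_cases hH : H = 0
  · exact ⟨0, by simp [hH]⟩
  have h1 := totalDegree_mul_of_isDomain hF.ne_zero hH
  rw [hGd.totalDegree (mul_ne_zero hF.ne_zero hH), hFd.totalDegree hF.ne_zero] at h1
  have h2 := totalDegree_eq_zero_iff_eq_C.mp (show H.totalDegree = 0 by omega)
  exact ⟨_, by rw [mul_comm, ← h2]⟩

end MvPolynomial

/-! ### Projective transformations and proportional forms. -/

section LinearChange

open MvPolynomial

/-- The substitution of linear forms with coefficient matrix `A` into `F`. -/
noncomputable def linearSubst (A : Matrix (Fin 5) (Fin 5) ℂ) (F : MvPolynomial (Fin 5) ℂ) :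
    MvPolynomial (Fin 5) ℂ :=
  aeval (fun i => ∑ j, C (A i j) * X j) F

theorem eval_linearSubst (A : Matrix (Fin 5) (Fin 5) ℂ) (F : MvPolynomial (Fin 5) ℂ)
    (v : Fin 5 → ℂ) : eval v (linearSubst A F) = eval (A *ᵥ v) F := by
  have h : (eval v).comp (aeval (fun i => ∑ j, C (A i j) * X j) :
      MvPolynomial (Fin 5) ℂ →ₐ[ℂ] MvPolynomial (Fin 5) ℂ).toRingHom = eval (A *ᵥ v) := by
    ext i
    · simp
    · simp [mulVec, dotProduct]
  exact congrArg (fun f : MvPolynomial (Fin 5) ℂ →+* ℂ => f F) h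

theorem isHomogeneous_linearSubst (A : Matrix (Fin 5) (Fin 5) ℂ) {F : MvPolynomial (Fin 5) ℂ}
    {d : ℕ} (hF : F.IsHomogeneous d) : (linearSubst A F).IsHomogeneous d := by
  have := hF.aeval (fun i => ∑ j, C (A i j) * X j) (n := 1) fun i =>
    IsHomogeneous.sum _ _ _ fun j _ => (isHomogeneous_X ℂ j).C_mul _
  rwa [one_mul] at this

theorem mk_smul_mk_mem_projZeroLocus {F : MvPolynomial (Fin 5) ℂ} {d : ℕ}
    (hF : F.IsHomogeneous d) (g : GL (Fin 5) ℂ) {v : Fin 5 → ℂ} (hv : v ≠ 0) :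
    (ProjGenLinGroup.mk g • Projectivization.mk ℂ v hv : P4) ∈ projZeroLocus F ↔
      eval (g.1 *ᵥ v) F = 0 := by
  rw [Projectivization.PGL.mk_smul_mk, mk_mem_projZeroLocus hF]
  rfl

theorem eval_zero_of_isHomogeneous {F : MvPolynomial (Fin 5) ℂ} {d : ℕ}
    (hF : F.IsHomogeneous d) (hd : d ≠ 0) : eval 0 F = 0 := by
  rw [show eval 0 F = constantCoeff F from by simp [constantCoeff_eq, eval_zero]]
  exact hF.coeff_eq_zero (by simpa using hd.symm)

/-- If a projective transformation carries the zero locus of an irreducible form to that of a form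
of the same degree, then the corresponding substitution maps one to a multiple of the other. -/
theorem exists_eval_mulVec_eq_mul {F F' : MvPolynomial (Fin 5) ℂ} {d : ℕ} (hd : d ≠ 0)
    (hF : Irreducible F) (hFd : F.IsHomogeneous d) (hFd' : F'.IsHomogeneous d) (hF' : F' ≠ 0)
    (g : GL (Fin 5) ℂ)
    (h : ProjGenLinGroup.mk g • projZeroLocus F = projZeroLocus F') :
    ∃ c : ℂ, c ≠ 0 ∧ ∀ v, eval (g.1 *ᵥ v) F' = c * eval v F := by
  obtain ⟨c, hc⟩ := eq_C_mul_of_zeros hF hFd (isHomogeneous_linearSubst g.1 hFd') (by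
    intro v hv
    rw [eval_linearSubst]
    by_cases hv0 : v = 0
    · rw [hv0, mulVec_zero, eval_zero_of_isHomogeneous hFd' hd]
    · rw [← mk_smul_mk_mem_projZeroLocus hFd' g hv0, ← h, Set.smul_mem_smul_set_iff,
        mk_mem_projZeroLocus hFd]
      exact hv)
  have key : ∀ v, eval (g.1 *ᵥ v) F' = c * eval v F := by
    intro v
    rw [← eval_linearSubst, hc]
    simp
  refine ⟨c, ?_, key⟩
  rintro rfl
  refine hF' (funext fun v => ?_)
  have := key (g⁻¹.1 *ᵥ v)
  rw [mulVec_mulVec, ← Units.val_mul, mul_inv_cancel] at this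
  simpa using this

/-- The converse direction: proportional forms have corresponding zero loci. -/
theorem mk_smul_projZeroLocus_eq {F F' : MvPolynomial (Fin 5) ℂ} {d : ℕ}
    (hFd : F.IsHomogeneous d) (hFd' : F'.IsHomogeneous d) (g : GL (Fin 5) ℂ) {c : ℂ} (hc : c ≠ 0)
    (h : ∀ v, eval (g.1 *ᵥ v) F' = c * eval v F) :
    ProjGenLinGroup.mk g • projZeroLocus F = projZeroLocus F' := by
  have key : ∀ p : P4, ProjGenLinGroup.mk g • p ∈ projZeroLocus F' ↔ p ∈ projZeroLocus F := by
    intro p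
    induction p using Projectivization.ind with
    | h v hv =>
      rw [mk_smul_mk_mem_projZeroLocus hFd', mk_mem_projZeroLocus hFd, h]
      simp [hc]
  ext p
  rw [Set.mem_smul_set_iff_inv_smul_mem, ← key, smul_inv_smul]

end LinearChange

theorem exists_unit_pow_three_eq (c : ℂˣ) : ∃ t : ℂˣ, t ^ 3 = c := by
  obtain ⟨t, ht⟩ := IsAlgClosed.exists_pow_nat_eq (c : ℂ) (n := 3) (by norm_num)
  have h0 : t ≠ 0 := by
    rintro rfl
    exact c.ne_zero (by rw [← ht]; norm_num)
  exact ⟨Units.mk0 t h0, Units.ext (by simpa using ht)⟩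

theorem exists_unit_ne_one_pow_three_eq_one : ∃ ω : ℂˣ, ω ^ 3 = 1 ∧ ω ≠ 1 := by
  have h := Complex.isPrimitiveRoot_exp 3 (by norm_num)
  obtain ⟨ω, hω⟩ := h.isUnit (by norm_num)
  refine ⟨ω, Units.ext ?_, fun h1 => ?_⟩
  · rw [Units.val_pow_eq_pow_val, hω, h.pow_eq_one, Units.val_one]
  · exact h.ne_one (by norm_num) (by rw [← hω, h1, Units.val_one])

/-! ### From a large diagonal symmetry group to the Fermat form. -/

section FermatBasis

variable {V : Type*} [AddCommGroup V] [Module ℂ V] {T : V →ₗ[ℂ] V →ₗ[ℂ] V →ₗ[ℂ] ℂ}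

/-- A nonsingular cubic form in five variables invariant under a diagonal `3`-group of order at
least `3 ^ 5` is a sum of five cubes. -/
theorem exists_fermat_basis {A : Type*} [Group A] [Finite A] (hA : IsPGroup 3 A)
    (hcard : 3 ^ 5 ≤ Nat.card A) (χ : A →* Fin 5 → ℂˣ) (hχ : Function.Injective χ)
    (b : Module.Basis (Fin 5) ℂ V) (hsm : ∀ v, v ≠ 0 → T v v ≠ 0)
    (hinv : ∀ a i j k, (χ a i * χ a j * χ a k : ℂ) * T (b i) (b j) (b k) = T (b i) (b j) (b k)) :
    ∃ b' : Module.Basis (Fin 5) ℂ V, ∀ i j k,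
      T (b' i) (b' j) (b' k) = if i = j ∧ j = k then 1 else 0 := by
  have hrel : ∀ {i j k}, T (b i) (b j) (b k) ≠ 0 → ∀ a, χ a i * χ a j * χ a k = 1 := by
    intro i j k h a
    refine Units.ext ?_
    simpa [h] using hinv a i j k
  have hex : ∀ i, ∃ j, T (b i) (b i) (b j) ≠ 0 := by
    intro i
    by_contra! h
    exact hsm (b i) (b.ne_zero i) (b.ext fun j => by simpa using h j)
  choose f hf using hex
  have hf' : ∀ a i, χ a i ^ 2 * χ a (f i) = 1 := fun a i => by
    rw [sq]
    exact hrel (hf i) a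
  have hdiag : ∀ i, T (b i) (b i) (b i) ≠ 0 := fun i => by
    have := hf i
    rwa [eq_self_of_character_relations hA hχ hf' hcard i] at this
  have hoff : ∀ i j k, ¬(i = j ∧ j = k) → T (b i) (b j) (b k) = 0 := by
    intro i j k hijk
    by_contra hne
    -- Among `i`, `j`, `k`, not all equal, some index occurs exactly once; the diagonal matrix with
    -- `ω` at that place multiplies the coefficient by `ω ≠ 1`.
    obtain ⟨ω, hω3, hω1⟩ := exists_unit_ne_one_pow_three_eq_one
    have hsingle : ∀ l, (Pi.mulSingle l ω : Fin 5 → ℂˣ) i * (Pi.mulSingle l ω : Fin 5 → ℂˣ) j *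
        (Pi.mulSingle l ω : Fin 5 → ℂˣ) k = 1 := by
      intro l
      obtain ⟨a, ha⟩ := exists_apply_eq_of_character_relations hA hχ hf' hcard
        (Pi.mulSingle l ω) (fun m => by
          rw [← Pi.pow_apply, ← Pi.mulSingle_pow, hω3, Pi.mulSingle_one]
          rfl)
      rw [← ha]
      exact hrel hne a
    by_cases hij : i = j
    · subst hij
      have hk : k ≠ i := fun h => hijk ⟨rfl, h.symm⟩
      have := hsingle k
      simp [Pi.mulSingle_eq_of_ne hk.symm] at this
      exact hω1 this
    · by_cases hik : i = k
      · subst hik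
        have := hsingle j
        simp [Pi.mulSingle_eq_of_ne hij] at this
        exact hω1 this
      · have := hsingle i
        simp [Pi.mulSingle_eq_of_ne (Ne.symm hij), Pi.mulSingle_eq_of_ne (Ne.symm hik)] at this
        exact hω1 this
  choose s hs using fun i => exists_unit_pow_three_eq (Units.mk0 _ (hdiag i))⁻¹
  refine ⟨b.unitsSMul s, fun i j k => ?_⟩
  simp only [Module.Basis.unitsSMul_apply, Units.smul_def, map_smul, LinearMap.smul_apply,
    smul_eq_mul]
  split_ifs with h
  · obtain ⟨rfl, rfl⟩ := h
    have := congrArg Units.val (hs i)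
    simp only [Units.val_pow_eq_pow_val, Units.val_inv_eq_inv_val, Units.val_mk0] at this
    calc _ = (s i : ℂ) ^ 3 * T (b i) (b i) (b i) := by ring
      _ = 1 := by rw [this, inv_mul_cancel₀ (hdiag i)]
  · rw [hoff i j k h]
    simp

/-- In a basis as in `exists_fermat_basis` the cubic form is the Fermat form. -/
theorem apply_self_eq_sum_cubes (b : Module.Basis (Fin 5) ℂ V)
    (hb : ∀ i j k, T (b i) (b j) (b k) = if i = j ∧ j = k then 1 else 0) (x : Fin 5 → ℂ) :
    T (∑ i, x i • b i) (∑ i, x i • b i) (∑ i, x i • b i) = ∑ i, x i ^ 3 := by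
  simp only [map_sum, LinearMap.sum_apply, map_smul, LinearMap.smul_apply, smul_eq_mul, hb,
    ite_and]
  refine Finset.sum_congr rfl fun i _ => ?_
  simp [pow_succ, mul_assoc]

end FermatBasis

theorem exists_GL_mulVec_eq {n : ℕ} (e : (Fin n → ℂ) ≃ₗ[ℂ] (Fin n → ℂ)) :
    ∃ g : GL (Fin n) ℂ, ∀ v, g.1 *ᵥ v = e v := by
  refine ⟨⟨LinearMap.toMatrix' e.toLinearMap, LinearMap.toMatrix' e.symm.toLinearMap, ?_, ?_⟩,
    fun v => ?_⟩
  · rw [← LinearMap.toMatrix'_comp, LinearEquiv.comp_symm, LinearMap.toMatrix'_id]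
  · rw [← LinearMap.toMatrix'_comp, LinearEquiv.symm_comp, LinearMap.toMatrix'_id]
  · exact LinearMap.toMatrix'_mulVec _ v

/-! ### Lifting projective automorphisms to linear ones. -/

section Lifting

open MvPolynomial

theorem MvPolynomial.IsHomogeneous.eval_smul {σ : Type*} {F : MvPolynomial σ ℂ} {d : ℕ}
    (hF : F.IsHomogeneous d) (c : ℂ) (v : σ → ℂ) : eval (c • v) F = c ^ d * eval v F := by
  rw [eval_eq, eval_eq, Finset.mul_sum]
  refine Finset.sum_congr rfl fun m hm => ?_
  simp only [Pi.smul_apply, smul_eq_mul, mul_pow, Finset.prod_mul_distrib,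
    Finset.prod_pow_eq_pow_sum]
  rw [hF.degree_eq_sum_deg_support hm]
  ring

variable {F : MvPolynomial (Fin 5) ℂ}

/-- The linear automorphisms of a cubic form whose classes lie in a given subgroup of the projective
linear group. -/
def formStabilizer (F : MvPolynomial (Fin 5) ℂ) (P : Subgroup PGL(5, ℂ)) :
    Subgroup (GL (Fin 5) ℂ) where
  carrier := {A | ProjGenLinGroup.mk A ∈ P ∧ ∀ v, eval (A.1 *ᵥ v) F = eval v F}
  one_mem' := ⟨P.one_mem, fun v => by simp⟩
  mul_mem' := by
    rintro A B ⟨hA, hA'⟩ ⟨hB, hB'⟩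
    refine ⟨by rw [map_mul]; exact P.mul_mem hA hB, fun v => ?_⟩
    rw [Units.val_mul, ← mulVec_mulVec, hA', hB']
  inv_mem' := by
    rintro A ⟨hA, hA'⟩
    refine ⟨by rw [map_inv]; exact P.inv_mem hA, fun v => ?_⟩
    rw [← hA', mulVec_mulVec, ← Units.val_mul, mul_inv_cancel, Units.val_one, one_mulVec]

theorem scalar_mulVec (u : ℂˣ) (v : Fin 5 → ℂ) :
    (GeneralLinearGroup.scalar (Fin 5) u).1 *ᵥ v = (u : ℂ) • v := by
  rw [GeneralLinearGroup.coe_scalar]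
  simp [Matrix.scalar_apply]

/-- An automorphism scales `F` by some `c`; multiplying a lift by a cube root of `c⁻¹` makes it fix
`F`. The remaining freedom is a scalar with cube `1`. -/
theorem card_formStabilizer (hF : Irreducible F) (hF3 : F.IsHomogeneous 3)
    (P : Subgroup PGL(5, ℂ)) (hP : P ≤ cubicAut (projZeroLocus F)) :
    Nat.card (formStabilizer F P) = 3 * Nat.card P := by
  let π : formStabilizer F P →* P :=
    (ProjGenLinGroup.mk.comp (formStabilizer F P).subtype).codRestrict P fun A => A.2.1
  have hπ : Function.Surjective π := by
    rintro ⟨p, hp⟩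
    obtain ⟨A, rfl⟩ := ProjGenLinGroup.mk_surjective p
    obtain ⟨c, hc, hA⟩ := exists_eval_mulVec_eq_mul three_ne_zero hF hF3 hF3 hF.ne_zero A (hP hp)
    obtain ⟨t, ht⟩ := exists_unit_pow_three_eq (Units.mk0 c hc)⁻¹
    have hmk : ProjGenLinGroup.mk (A * GeneralLinearGroup.scalar (Fin 5) t) =
        ProjGenLinGroup.mk A := by rw [map_mul, ProjGenLinGroup.mk_scalar, mul_one]
    refine ⟨⟨A * GeneralLinearGroup.scalar (Fin 5) t, by rw [hmk]; exact hp, fun v => ?_⟩,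
      Subtype.ext hmk⟩
    have ht' := congrArg Units.val ht
    simp only [Units.val_pow_eq_pow_val, Units.val_inv_eq_inv_val, Units.val_mk0] at ht'
    rw [Units.val_mul, ← mulVec_mulVec, scalar_mulVec, hA, hF3.eval_smul, ht', ← mul_assoc,
      mul_inv_cancel₀ hc, one_mul]
  have hker : Nat.card π.ker = 3 := by
    obtain ⟨v, hv⟩ : ∃ v, eval v F ≠ 0 := by
      by_contra! h
      exact hF.ne_zero (MvPolynomial.funext fun v => by simpa using h v)
    rw [← Complex.card_rootsOfUnity 3]
    symm
    let φ : rootsOfUnity 3 ℂ → π.ker := fun u =>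
      ⟨⟨GeneralLinearGroup.scalar (Fin 5) u.1, by
        rw [ProjGenLinGroup.mk_scalar]; exact P.one_mem, fun v => by
        have := congrArg Units.val u.2
        rw [scalar_mulVec, hF3.eval_smul, ← Units.val_pow_eq_pow_val, this, Units.val_one,
          one_mul]⟩, Subtype.ext (ProjGenLinGroup.mk_scalar u.1)⟩
    refine Nat.card_eq_of_bijective φ ⟨fun u w huw => ?_, ?_⟩
    · have h1 : GeneralLinearGroup.scalar (Fin 5) u.1 = GeneralLinearGroup.scalar (Fin 5) w.1 :=
        congrArg (fun x : π.ker => x.1.1) huw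
      have h2 := scalar_mulVec u.1 1
      rw [h1, scalar_mulVec] at h2
      exact Subtype.ext (Units.ext (by simpa using (congrFun h2 0).symm))
    · rintro ⟨⟨A, hA1, hA2⟩, hA⟩
      have hA' : ProjGenLinGroup.mk A = ProjGenLinGroup.mk 1 :=
        congrArg Subtype.val (MonoidHom.mem_ker.mp hA)
      obtain ⟨u, hu⟩ := ProjGenLinGroup.mk_eq_mk_iff.mp hA'.symm
      rw [one_mul] at hu
      subst hu
      refine ⟨⟨u, Units.ext ?_⟩, rfl⟩
      have := hA2 v
      rw [scalar_mulVec, hF3.eval_smul] at this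
      simpa [hv] using this
  rw [← π.ker.card_mul_index, Subgroup.index_ker, hker, MonoidHom.range_eq_top.mpr hπ,
    Subgroup.card_top]

/-- A smooth cubic form in five variables with a group of projective automorphisms of order `3 ^ 5`
is linearly equivalent to the Fermat form. -/
theorem exists_eval_mulVec_eq_sum_cubes (hF : Irreducible F) (hF3 : F.IsHomogeneous 3)
    (hsm : ∀ v : Fin 5 → ℂ, v ≠ 0 → eval v F = 0 → ∃ i, eval v (pderiv i F) ≠ 0)
    (P : Subgroup PGL(5, ℂ)) (hP : P ≤ cubicAut (projZeroLocus F)) (hcard : Nat.card P = 3 ^ 5) :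
    ∃ g : GL (Fin 5) ℂ, ∀ v, eval (g.1 *ᵥ v) F = ∑ i, v i ^ 3 := by
  obtain ⟨T, hT, hTF, hTd⟩ := hF3.exists_symmTrilinear
  have hQcard : Nat.card (formStabilizer F P) = 3 ^ 6 := by
    rw [card_formStabilizer hF hF3 P hP, hcard]
    norm_num
  have hfin : Finite (formStabilizer F P) := Nat.finite_of_card_ne_zero (by rw [hQcard]; norm_num)
  have hQ : IsPGroup 3 (formStabilizer F P) := IsPGroup.of_card hQcard
  have : Fact (Nat.Prime 3) := ⟨Nat.prime_three⟩
  let ρ : formStabilizer F P →* Module.End ℂ (Fin 5 → ℂ) :=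
    (toLinAlgEquiv' : Matrix (Fin 5) (Fin 5) ℂ ≃ₐ[ℂ] _).toAlgHom.toRingHom.toMonoidHom.comp
      ((Units.coeHom _).comp (formStabilizer F P).subtype)
  have hρ_apply : ∀ A v, ρ A v = A.1.1 *ᵥ v := fun _ _ => rfl
  have hρ : Function.Injective ρ := fun A B hAB => Subtype.ext (Units.ext
    (toLinAlgEquiv'.injective hAB))
  obtain ⟨A, hindex, b, χ₀, hχ₀⟩ := hQ.exists_diagonal_subgroup ρ hρ (n := 5) (by simp)
  have hAcard : 3 ^ 5 ≤ Nat.card A := by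
    have hmul := A.card_mul_index
    -- `gcd (5!, 3 ^ 6) = 3`.
    have h3 : A.index ∣ 3 := by
      have := Nat.dvd_gcd hindex (hQcard ▸ A.index_dvd_card)
      exact this.trans (by decide)
    have h3' := Nat.le_of_dvd (by norm_num) h3
    rw [hQcard] at hmul
    have := Nat.mul_le_mul_left (Nat.card A) h3'
    omega
  have hχ_unique : ∀ i {c d : ℂ}, c • b i = d • b i → c = d := fun i _ _ h =>
    smul_left_injective ℂ (b.ne_zero i) h
  have hχ_one : ∀ i, χ₀ i 1 = 1 := fun i => hχ_unique i (by rw [← hχ₀]; simp)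
  have hχ_mul : ∀ i x y, χ₀ i (x * y) = χ₀ i x * χ₀ i y := fun i x y => hχ_unique i (by
    rw [← hχ₀, Subgroup.coe_mul, map_mul, Module.End.mul_apply, hχ₀, map_smul, hχ₀, smul_smul,
      mul_comm])
  let χ₁ : Fin 5 → A →* ℂ := fun i => ⟨⟨χ₀ i, hχ_one i⟩, hχ_mul i⟩
  let χ : A →* Fin 5 → ℂˣ := MonoidHom.pi fun i => (χ₁ i).toHomUnits
  have hχ_apply : ∀ a i, (χ a i : ℂ) = χ₀ i a := fun _ _ => rfl
  have hχ : Function.Injective χ := fun x y hxy => Subtype.ext (hρ (b.ext fun i => by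
    rw [hχ₀, hχ₀, ← hχ_apply, hxy, hχ_apply]))
  obtain ⟨b', hb'⟩ := exists_fermat_basis (hQ.to_subgroup A) hAcard χ hχ b (T := T)
    -- If `T v v = 0`, then `F` and all its partial derivatives vanish at `v`, against smoothness.
    (fun v hv h0 => by
      obtain ⟨i, hi⟩ := hsm v hv (by rw [← hTF, h0, LinearMap.zero_apply])
      rw [← hTd, h0] at hi
      simp at hi)
    (fun a i j k => by
      have := hT.map_eq_mul hT (ρ a) 1 (fun v => by
        rw [hTF, hTF, one_mul, hρ_apply]
        exact a.1.2.2 v) (b i) (b j) (b k)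
      rw [hχ₀, hχ₀, hχ₀] at this
      simp only [map_smul, LinearMap.smul_apply, smul_eq_mul, one_mul, ← hχ_apply] at this
      rw [mul_assoc, mul_assoc]
      linear_combination this)
  obtain ⟨g, hg⟩ := exists_GL_mulVec_eq b'.equivFun.symm
  refine ⟨g, fun v => ?_⟩
  rw [hg, Module.Basis.equivFun_symm_apply, ← hTF, apply_self_eq_sum_cubes b' hb']

end Lifting

/-! ### Automorphisms of the Fermat cubic as monomial matrices. -/

section FermatAutomorphisms

/-- The symmetric trilinear form `∑ uᵢ vᵢ wᵢ` of the Fermat cubic. -/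
noncomputable def fermatTrilinear : (Fin 5 → ℂ) →ₗ[ℂ] (Fin 5 → ℂ) →ₗ[ℂ] (Fin 5 → ℂ) →ₗ[ℂ] ℂ :=
  ∑ i, (LinearMap.proj i).smulRight ((LinearMap.proj i).smulRight (LinearMap.proj i))

theorem fermatTrilinear_apply (u v w : Fin 5 → ℂ) :
    fermatTrilinear u v w = ∑ i, u i * v i * w i := by
  simp [fermatTrilinear, mul_assoc]

theorem isSymmTrilinear_fermatTrilinear : IsSymmTrilinear fermatTrilinear where
  swap_left u v w := by simp only [fermatTrilinear_apply, mul_comm (u _)]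
  swap_right u v w := by simp only [fermatTrilinear_apply, mul_right_comm]

/-- A linear automorphism of the Fermat form up to scaling is a monomial matrix whose entries have
equal cubes. -/
theorem exists_monomial_of_sum_cubes (A : GL (Fin 5) ℂ) {c : ℂ}
    (hA : ∀ v, ∑ i, (A.1 *ᵥ v) i ^ 3 = c * ∑ i, v i ^ 3) :
    ∃ (τ : Equiv.Perm (Fin 5)) (α : Fin 5 → ℂ), (∀ k, α k ^ 3 = c) ∧
      ∀ v k, (A.1 *ᵥ v) k = α k * v (τ k) := by
  have htri := isSymmTrilinear_fermatTrilinear.map_eq_mul isSymmTrilinear_fermatTrilinear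
    (toLin' A.1) c (fun v => by
      simpa only [fermatTrilinear_apply, toLin'_apply, ← pow_two, ← pow_succ] using hA v)
  simp only [fermatTrilinear_apply, toLin'_apply] at htri
  have hinv : ∀ v, A.1 *ᵥ (A⁻¹.1 *ᵥ v) = v := fun v => by
    rw [mulVec_mulVec, ← Units.val_mul, mul_inv_cancel, Units.val_one, one_mulVec]
  have hinj : ∀ v, A.1 *ᵥ v = 0 → v = 0 := fun v h => by
    have h1 : A⁻¹.1 *ᵥ (A.1 *ᵥ v) = v := by
      rw [mulVec_mulVec, ← Units.val_mul, inv_mul_cancel, Units.val_one, one_mulVec]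
    rw [← h1, h, mulVec_zero]
  have hrow : ∀ i j k, i ≠ j → A.1 k i * A.1 k j = 0 := by
    intro i j k hij
    -- The third argument is chosen so that its image is the `k`-th unit vector, which isolates row
    -- `k`.
    have := htri (Pi.single i 1) (Pi.single j 1) (A⁻¹.1 *ᵥ Pi.single k 1)
    rw [hinv] at this
    simpa [Pi.single_apply, hij, hij.symm] using this
  have hex : ∀ k, ∃ j, A.1 k j ≠ 0 := by
    intro k
    by_contra! h
    have := congrFun (hinv (Pi.single k 1)) k
    simp [mulVec, dotProduct, h] at this
  choose τ hτ using hex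
  have hzero : ∀ k j, j ≠ τ k → A.1 k j = 0 := fun k j hj =>
    (mul_eq_zero.mp (hrow j (τ k) k hj)).resolve_right (hτ k)
  have happ : ∀ v k, (A.1 *ᵥ v) k = A.1 k (τ k) * v (τ k) := fun v k =>
    Finset.sum_eq_single (s := Finset.univ) (f := fun j => A.1 k j * v j) (τ k)
      (fun j _ hj => by rw [hzero k j hj, zero_mul]) (by simp)
  have hsurj : Function.Surjective τ := by
    intro j
    by_contra! h
    have h0 := hinj (Pi.single j 1) (funext fun k => by simp [happ, h])
    simpa using congrFun h0 j
  let e : Equiv.Perm (Fin 5) := Equiv.ofBijective τ (Finite.surjective_iff_bijective.mp hsurj)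
  refine ⟨e, fun k => A.1 k (τ k), fun k => ?_, happ⟩
  have := hA (Pi.single (τ k) 1)
  simp only [happ] at this
  rw [Finset.sum_eq_single k (fun i _ hi => by
    rw [Pi.single_eq_of_ne (show τ i ≠ τ k from fun h => hi (e.injective h)), mul_zero,
      zero_pow three_ne_zero])
    (by simp)] at this
  simpa [Pi.single_apply] using this

/-- The group `C₃` as the group of complex cube roots of unity. -/
noncomputable def cubeRootsEquiv : Multiplicative (ZMod 3) ≃* rootsOfUnity 3 ℂ :=
  mulEquivOfCyclicCardEq (by
    rw [Complex.card_rootsOfUnity, Nat.card_congr Multiplicative.toAdd, Nat.card_zmod])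

/-- An element of `C₃` as a complex number. -/
noncomputable def cubeRoot : Multiplicative (ZMod 3) →* ℂ :=
  (Units.coeHom ℂ).comp ((rootsOfUnity 3 ℂ).subtype.comp cubeRootsEquiv.toMonoidHom)

theorem cubeRoot_injective : Function.Injective cubeRoot := fun _ _ h =>
  cubeRootsEquiv.injective (Subtype.ext (Units.ext h))

theorem cubeRoot_ne_zero (a : Multiplicative (ZMod 3)) : cubeRoot a ≠ 0 :=
  (cubeRootsEquiv a).1.ne_zero

theorem exists_cubeRoot_eq {z : ℂ} (hz : z ^ 3 = 1) : ∃ a, cubeRoot a = z := by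
  obtain ⟨a, ha⟩ := cubeRootsEquiv.surjective (rootsOfUnity.mkOfPowEq z hz)
  exact ⟨a, by
    change ((cubeRootsEquiv a : ℂˣ) : ℂ) = z
    rw [ha]
    rfl⟩

/-- The monomial matrix of an element of `C₃⁴ ⋊ S₅`. -/
noncomputable def monomialMatrix (x : C3pow4S5) : Matrix (Fin 5) (Fin 5) ℂ :=
  Matrix.of fun i j => if x.right⁻¹ i = j then cubeRoot (x.left.1 i) else 0

theorem monomialMatrix_mulVec (x : C3pow4S5) (v : Fin 5 → ℂ) (i : Fin 5) :
    (monomialMatrix x *ᵥ v) i = cubeRoot (x.left.1 i) * v (x.right⁻¹ i) := by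
  simp [monomialMatrix, mulVec, dotProduct]

/-- The representation of `C₃⁴ ⋊ S₅` by monomial matrices. -/
noncomputable def monomialHom : C3pow4S5 →* GL (Fin 5) ℂ :=
  MonoidHom.toHomUnits
    { toFun := monomialMatrix
      map_one' := ext_of_mulVec_single fun i => by
        ext j
        rw [monomialMatrix_mulVec, one_mulVec, SemidirectProduct.one_left,
          SemidirectProduct.one_right, inv_one, Equiv.Perm.one_apply]
        change cubeRoot 1 * _ = _
        rw [map_one, one_mul]
      map_mul' := fun x y => ext_of_mulVec_single fun i => by
        ext j
        rw [← mulVec_mulVec, monomialMatrix_mulVec, monomialMatrix_mulVec, monomialMatrix_mulVec,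
          ← mul_assoc, ← map_mul, SemidirectProduct.mul_right, _root_.mul_inv_rev]
        rfl }

theorem monomialHom_mulVec (x : C3pow4S5) (v : Fin 5 → ℂ) (i : Fin 5) :
    ((monomialHom x).1 *ᵥ v) i = cubeRoot (x.left.1 i) * v (x.right⁻¹ i) :=
  monomialMatrix_mulVec x v i

/-- A scalar matrix in the image is a constant tuple `a` with `a ^ 5 = 1`, which is trivial in `C₃`
because `5` is prime to `3`. -/
theorem mk_comp_monomialHom_injective :
    Function.Injective (ProjGenLinGroup.mk.comp monomialHom) := by
  rw [injective_iff_map_eq_one]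
  intro x hx
  obtain ⟨u, hu⟩ := ProjGenLinGroup.mk_eq_mk_iff.mp (show ProjGenLinGroup.mk 1 =
    ProjGenLinGroup.mk (monomialHom x) from hx.symm)
  rw [one_mul] at hu
  have key : ∀ (v : Fin 5 → ℂ) i, cubeRoot (x.left.1 i) * v (x.right⁻¹ i) = u * v i := fun v i => by
    rw [← monomialHom_mulVec, ← hu, scalar_mulVec, Pi.smul_apply, smul_eq_mul]
  have hfix : ∀ i, x.right⁻¹ i = i := fun i => by
    by_contra h
    have := key (Pi.single i 1) i
    rw [Pi.single_eq_of_ne h, Pi.single_eq_same, mul_zero, mul_one] at this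
    exact u.ne_zero this.symm
  have hconst : ∀ i, x.left.1 i = x.left.1 0 := fun i => cubeRoot_injective (by
    have h1 := key 1 i
    have h2 := key 1 0
    simp only [Pi.one_apply, mul_one] at h1 h2
    rw [h1, h2])
  have hprod : ∏ i, x.left.1 i = 1 := x.left.2
  simp only [hconst, Finset.prod_const, Finset.card_univ, Fintype.card_fin] at hprod
  have hC3 : ∀ a : Multiplicative (ZMod 3), a ^ 5 = 1 → a = 1 := by decide
  refine SemidirectProduct.ext (Subtype.ext (funext fun i => ?_)) ?_
  · rw [hconst, hC3 _ hprod]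
    rfl
  · exact inv_eq_one.mp (Equiv.ext hfix)

/-- A linear automorphism of the Fermat form up to scaling acts on projective space as an element
of `C₃⁴ ⋊ S₅`. -/
theorem mk_mem_range_monomialHom (A : GL (Fin 5) ℂ) {c : ℂ} (hc : c ≠ 0)
    (hA : ∀ v, ∑ i, (A.1 *ᵥ v) i ^ 3 = c * ∑ i, v i ^ 3) :
    ProjGenLinGroup.mk A ∈ (ProjGenLinGroup.mk.comp monomialHom).range := by
  obtain ⟨τ, α, hα, hAα⟩ := exists_monomial_of_sum_cubes A hA
  obtain ⟨t, ht⟩ := exists_unit_pow_three_eq (Units.mk0 c hc)⁻¹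
  replace ht : (t : ℂ) ^ 3 = c⁻¹ := by simpa using congrArg Units.val ht
  have hβ : ∀ k, (t * α k) ^ 3 = 1 := fun k => by
    rw [mul_pow, ht, hα, inv_mul_cancel₀ hc]
  choose β hβ' using fun k => exists_cubeRoot_eq (hβ k)
  -- Multiplying all entries by their product `∏ β` turns the product into `(∏ β) ^ 6 = 1`, and is
  -- invisible projectively.
  obtain ⟨s, hs⟩ : ∃ s : ℂˣ, (s : ℂ) = cubeRoot (∏ k, β k) :=
    ⟨Units.mk0 _ (cubeRoot_ne_zero _), rfl⟩
  have hC3 : ∀ a : Multiplicative (ZMod 3), a ^ 5 * a = 1 := by decide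
  let x : C3pow4S5 := ⟨⟨fun k => (∏ k, β k) * β k, by
    change ∏ k, ((∏ k, β k) * β k) = 1
    rw [Finset.prod_mul_distrib, Finset.prod_const, Finset.card_univ, Fintype.card_fin]
    exact hC3 _⟩, τ⁻¹⟩
  refine ⟨x, ?_⟩
  have hx : monomialHom x = A * GeneralLinearGroup.scalar (Fin 5) (s * t) := by
    refine Units.ext (ext_of_mulVec_single fun i => ?_)
    ext k
    rw [monomialHom_mulVec, Units.val_mul, ← mulVec_mulVec, scalar_mulVec, mulVec_smul,
      Pi.smul_apply, hAα]
    change cubeRoot ((∏ k, β k) * β k) * _ = _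
    rw [map_mul, hβ', ← hs, Units.val_mul, smul_eq_mul]
    simp only [x, inv_inv]
    ring
  rw [MonoidHom.comp_apply, hx, map_mul, ProjGenLinGroup.mk_scalar, mul_one]

end FermatAutomorphisms

/-! ### Transport to the Fermat cubic and conclusion. -/

section Transport

theorem isHomogeneous_fermat :
    (∑ i : Fin 5, MvPolynomial.X i ^ 3 : MvPolynomial (Fin 5) ℂ).IsHomogeneous 3 :=
  MvPolynomial.IsHomogeneous.sum _ _ _ fun i _ => MvPolynomial.isHomogeneous_X_pow i 3

theorem eval_fermat (v : Fin 5 → ℂ) :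
    MvPolynomial.eval v (∑ i : Fin 5, MvPolynomial.X i ^ 3) = ∑ i, v i ^ 3 := by
  simp

/-- If some irreducible cubic form is linearly equivalent to the Fermat form, the automorphism group
of the Fermat cubic is contained in the group of monomial transformations. -/
theorem cubicAut_fermatCubic_le {F : MvPolynomial (Fin 5) ℂ} (hF : Irreducible F)
    (hF3 : F.IsHomogeneous 3) (g : GL (Fin 5) ℂ)
    (hg : ∀ v, MvPolynomial.eval (g.1 *ᵥ v) F = ∑ i, v i ^ 3)
    (hgF : ProjGenLinGroup.mk g • fermatCubic = projZeroLocus F) :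
    cubicAut fermatCubic ≤ (ProjGenLinGroup.mk.comp monomialHom).range := by
  intro p hp
  obtain ⟨A, rfl⟩ := ProjGenLinGroup.mk_surjective p
  have hne : (∑ i : Fin 5, MvPolynomial.X i ^ 3 : MvPolynomial (Fin 5) ℂ) ≠ 0 := by
    intro h
    have := congrArg (MvPolynomial.eval (Pi.single 0 1)) h
    rw [eval_fermat] at this
    simp [Pi.single_apply] at this
  -- Composing with `g⁻¹` makes `F` the source form, so irreducibility is needed for `F` only and
  -- not for the Fermat form.
  obtain ⟨c, hc, hA⟩ := exists_eval_mulVec_eq_mul three_ne_zero hF hF3 isHomogeneous_fermat hne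
    (A * g⁻¹) (by
      rw [map_mul, mul_smul, ← hgF, map_inv, inv_smul_smul]
      exact hp)
  refine mk_mem_range_monomialHom A hc fun v => ?_
  have := hA (g.1 *ᵥ v)
  rwa [mulVec_mulVec, ← Units.val_mul, inv_mul_cancel_right, eval_fermat, hg] at this

/-- A group carried into `K` by an injective homomorphism is isomorphic to a subgroup of `K`. -/
theorem exists_subgroup_mulEquiv {G K : Type*} [Group G] [Group K] (φ : G →* K)
    (hφ : Function.Injective φ) : ∃ H : Subgroup K, Nonempty (G ≃* H) :=
  ⟨φ.range, ⟨MonoidHom.ofInjective hφ⟩⟩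

end Transport

theorem proposition6p4 (X : Set P4) (hX : IsSmoothCubicThreefold X)
    (G : Subgroup (cubicAut X)) (k : ℕ) (hk : 0 < k) (hG : Nat.card G = 3 ^ 5 * k) :
    (∃ g : PGL(5, ℂ), g • X = fermatCubic) ∧
    (∃ H : Subgroup (cubicAut fermatCubic), Nonempty (G ≃* H)) ∧
    (∃ H : Subgroup C3pow4S5, Nonempty (G ≃* H)) := by
  obtain ⟨F, hF, hF3, hsm, rfl⟩ := hX
  have hfin : Finite G := Nat.finite_of_card_ne_zero (by rw [hG]; positivity)
  have : Fact (Nat.Prime 3) := ⟨Nat.prime_three⟩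
  obtain ⟨P₀, hP₀⟩ := Sylow.exists_subgroup_card_pow_prime 3 (Dvd.intro k hG.symm)
  let ι : G →* PGL(5, ℂ) := (cubicAut (projZeroLocus F)).subtype.comp G.subtype
  have hι : Function.Injective ι := Subtype.val_injective.comp Subtype.val_injective
  obtain ⟨g, hg⟩ := exists_eval_mulVec_eq_sum_cubes hF hF3 hsm (P₀.map ι)
    (by
      rintro _ ⟨x, -, rfl⟩
      exact x.1.2)
    (by rw [Subgroup.card_map_of_injective hι, hP₀])
  have hgF : ProjGenLinGroup.mk g • fermatCubic = projZeroLocus F :=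
    mk_smul_projZeroLocus_eq isHomogeneous_fermat hF3 g one_ne_zero fun v => by
      rw [hg, eval_fermat, one_mul]
  let q : PGL(5, ℂ) := ProjGenLinGroup.mk g
  have hconj : ∀ x : G, q⁻¹ * ι x * q ∈ cubicAut fermatCubic := fun x => by
    have hx : ι x • projZeroLocus F = projZeroLocus F := x.1.2
    change (q⁻¹ * ι x * q) • fermatCubic = fermatCubic
    rw [mul_smul, mul_smul, hgF, hx, ← hgF, inv_smul_smul]
  let φ : G →* cubicAut fermatCubic :=
    ((MulAut.conj q⁻¹).toMonoidHom.comp ι).codRestrict _ fun x => by simpa using hconj x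
  have hφ : Function.Injective φ := fun x y hxy =>
    hι ((MulAut.conj q⁻¹).injective (congrArg Subtype.val hxy))
  let e := MonoidHom.ofInjective mk_comp_monomialHom_injective
  let ψ : cubicAut fermatCubic →* C3pow4S5 :=
    e.symm.toMonoidHom.comp (Subgroup.inclusion (cubicAut_fermatCubic_le hF hF3 g hg hgF))
  have hψ : Function.Injective ψ := e.symm.injective.comp (Subgroup.inclusion_injective _)
  exact ⟨⟨q⁻¹, by rw [← hgF, inv_smul_smul]⟩, exists_subgroup_mulEquiv φ hφ,
    exists_subgroup_mulEquiv (ψ.comp φ) (hψ.comp hφ)⟩
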